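/- Let $\mathbb K\in\{\mathbb R,\mathbb C\}$, let $\mathfrak k$ be a finite-dimensional Lie algebra over $\mathbb K$, let $M$ be a smooth, finite-dimensional, Hausdorff, paracompact, connected real manifold, and let $\pi:\mathbb L\to M$ be a bundle of Lie algebras with fiber $\mathfrak k$, i.e. a smooth $\mathbb K$-vector bundle with typical fiber $\mathfrak k$ and a bundle atlas whose transition maps take values in $\operatorname{Aut}(\mathfrak k)$; each fiber $\mathbb L_x$ carries the Lie bracket transported from $\mathfrak k$ by the bundle charts. For $k\in\{0,1,2,\dots\}\cup\{\infty\}$ let $\Gamma^k(\mathbb L)$ be the Lie algebra of $\operatorname{C}^k$-sections of $\mathbb L$ with the pointwise bracket. For a Lie algebra $\mathfrak g$ over $\mathbb K$ let $\operatorname{Cent}(\mathfrak g)=\{f\in\operatorname{End}_{\mathbb K}(\mathfrak g) : f[x,y]=[x,f(y)]\text{ for all }x,y\in\mathfrak g\}$ be its centroid, an associative algebra under composition. Let $\operatorname{Cent}(\mathbb L)\subseteq\operatorname{Hom}(\mathbb L,\mathbb L)$ be the subbundle with fibers $\operatorname{Cent}(\mathbb L_x)$, and let $\Gamma^k(\operatorname{Cent}(\mathbb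 L))$ be the associative algebra of its $\operatorname{C}^k$-sections under pointwise composition. If $\mathfrak k$ is perfect ($[\mathfrak k,\mathfrak k]=\mathfrak k$) or centerfree (its center is $0$), then for every $k\in\{0,1,2,\dots\}\cup\{\infty\}$ we have $$\operatorname{Cent}\bigl(\Gamma^k(\mathbb L)\bigr)\;\cong\;\Gamma^k\bigl(\operatorname{Cent}(\mathbb L)\bigr)$$ as associative $\mathbb K$-algebras. More precisely, there is an isomorphism $\Psi$ of associative $\mathbb K$-algebras from the left-hand side to the right-hand side with $\Psi(A)_x(X_x)=(AX)_x$ for all $A\in\operatorname{Cent}(\Gamma^k(\mathbb L))$, $X\in\Gamma^k(\mathbb L)$ and $x\in M$. -/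

import Mathlib

open Bundle
open scoped Manifold ContDiff

/-- A Lie ring with a norm on its additive group. No relation between norm and bracket is
required; the norm only provides the topology and differentiable structure used for the typical
fiber of a bundle (for a finite-dimensional Lie algebra, norms exist and are all equivalent). -/
class NormedLieRing (𝔨 : Type*) extends NormedAddCommGroup 𝔨, LieRing 𝔨

/-- A Lie algebra over a normed field, on a space with a norm; again norm and bracket are not
related. -/
class NormedLieAlgebra (K : Type*) [NormedField K] (𝔨 : Type*) [NormedLieRing 𝔨] extends
  NormedSpace K 𝔨, LieAlgebra K 𝔨

/-- The centroid of a Lie algebra `𝔤`: the associative algebra of all linear endomorphisms `f` with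
`f ⁅x, y⁆ = ⁅x, f y⁆`, i.e. commuting with all `ad x`. -/
def LieAlgebra.centroid (K : Type*) [CommRing K] (𝔤 : Type*) [LieRing 𝔤] [LieAlgebra K 𝔤] :
    Subalgebra K (Module.End K 𝔤) where
  carrier := {f | ∀ x y : 𝔤, f ⁅x, y⁆ = ⁅x, f y⁆}
  mul_mem' {f g} hf hg x y := by
    simp only [Set.mem_ofPred_eq] at hf hg
    simp [hf, hg]
  add_mem' {f g} hf hg x y := by
    simp only [Set.mem_ofPred_eq] at hf hg
    simp [hf, hg]
  algebraMap_mem' r x y := by simp [Module.algebraMap_end_apply]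

/-- A Lie algebra is perfect if it is spanned by its brackets. -/
def LieAlgebra.IsPerfect (K : Type*) [CommRing K] (𝔤 : Type*) [LieRing 𝔤] [LieAlgebra K 𝔤] :
    Prop :=
  Submodule.span K {z : 𝔤 | ∃ x y : 𝔤, ⁅x, y⁆ = z} = ⊤

/-- A Lie algebra is centerfree if `0` is the only element commuting with all elements. -/
def LieAlgebra.IsCenterfree (K : Type*) [CommRing K] (𝔤 : Type*) [LieRing 𝔤] [LieAlgebra K 𝔤] :
    Prop :=
  LieAlgebra.center K 𝔤 = ⊥

section Fiber

variable {K : Type*} [RCLike K] {𝔨 : Type*} [NormedLieRing 𝔨] [NormedLieAlgebra K 𝔨]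
  [NormedSpace ℝ 𝔨] [IsScalarTower ℝ K 𝔨]

theorem contDiff_const_smul_fiber (c : K) : ContDiff ℝ ω (fun v : 𝔨 ↦ c • v) :=
  ((contDiff_id (𝕜 := K) (E := 𝔨)).const_smul c).restrict_scalars ℝ

theorem contDiff_lie_fiber (K : Type*) [RCLike K] {𝔨 : Type*} [NormedLieRing 𝔨]
    [NormedLieAlgebra K 𝔨] [NormedSpace ℝ 𝔨] [IsScalarTower ℝ K 𝔨] [FiniteDimensional K 𝔨] :
    ContDiff ℝ ω (fun p : 𝔨 × 𝔨 ↦ ⁅p.1, p.2⁆) := by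
  let f : 𝔨 →ₗ[K] 𝔨 →L[K] 𝔨 :=
    LinearMap.toContinuousLinearMap.toLinearMap ∘ₗ (LieModule.toEnd K 𝔨 𝔨 : 𝔨 →ₗ[K] 𝔨 →ₗ[K] 𝔨)
  have h := (LinearMap.toContinuousLinearMap f).isBoundedBilinearMap.contDiff (n := ω)
  exact h.restrict_scalars ℝ

theorem contDiff_comp_fiber :
    ContDiff ℝ ω (fun p : (𝔨 →L[K] 𝔨) × (𝔨 →L[K] 𝔨) ↦ p.1.comp p.2) :=
  (isBoundedBilinearMap_comp (𝕜 := K) (E := 𝔨) (F := 𝔨) (G := 𝔨)).contDiff.restrict_scalars ℝ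

end Fiber

/-- Let `L → M` be a vector bundle over the field `K` whose typical fiber `𝔨` and whose fibers `L x`
are Lie algebras. It is a bundle of Lie algebras if the charts of its bundle atlas restrict to
isomorphisms of Lie algebras `L x ≃ 𝔨` on the fibers (the charts are bijective and linear on fibers
anyway). Equivalently, the cocycle of the bundle atlas takes values in `Aut 𝔨`, and the bracket on
`L x` is transported from `𝔨` by any bundle chart at `x`. -/
class IsLieAlgebraBundle {M : Type*} [TopologicalSpace M] (𝔨 : Type*) [NormedLieRing 𝔨]
    (L : M → Type*) [∀ x, LieRing (L x)] [∀ x, TopologicalSpace (L x)]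
    [TopologicalSpace (TotalSpace 𝔨 L)] [FiberBundle 𝔨 L] : Prop where
  map_lie : ∀ (e : Trivialization 𝔨 (π 𝔨 L)) [MemTrivializationAtlas e], ∀ x ∈ e.baseSet,
    ∀ v w : L x, (e ⟨x, ⁅v, w⁆⟩).2 = ⁅(e ⟨x, v⟩).2, (e ⟨x, w⟩).2⁆

section LieBundle

/- `M` is a real manifold modelled on `EM`, and `L → M` is a bundle of Lie algebras over `K` with
typical fiber `𝔨`. -/
variable (K : Type*) [RCLike K]
  (EM : Type*) [NormedAddCommGroup EM] [NormedSpace ℝ EM]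
  {M : Type*} [TopologicalSpace M] [ChartedSpace EM M]
  (𝔨 : Type*) [NormedLieRing 𝔨] [NormedLieAlgebra K 𝔨] [NormedSpace ℝ 𝔨] [IsScalarTower ℝ K 𝔨]
  (L : M → Type*) [∀ x, LieRing (L x)] [∀ x, LieAlgebra K (L x)]
  [∀ x, TopologicalSpace (L x)] [TopologicalSpace (TotalSpace 𝔨 L)] [FiberBundle 𝔨 L]
  [VectorBundle K 𝔨 L]

/-- `Γ^k(L)`: the `K`-vector space of all `C^k` sections `X : M → L`, where `C^k` is meant over `ℝ`. -/
def LieSections (k : ℕ∞) : Submodule K (Π x, L x) where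
  carrier := {X | ContMDiff 𝓘(ℝ, EM) (𝓘(ℝ, EM).prod 𝓘(ℝ, 𝔨)) k
    (fun x ↦ (⟨x, X x⟩ : TotalSpace 𝔨 L))}
  zero_mem' := by
    intro x₀
    rw [contMDiffAt_section]
    refine (contMDiffAt_const (c := (0 : 𝔨))).congr_of_eventuallyEq ?_
    filter_upwards [(trivializationAt 𝔨 L x₀).open_baseSet.mem_nhds
      (mem_baseSet_trivializationAt 𝔨 L x₀)] with y hy
    exact ((trivializationAt 𝔨 L x₀).linear K hy).map_zero
  add_mem' {X Y} hX hY := by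
    intro x₀
    have hX := (contMDiffAt_section x₀).1 (hX x₀)
    have hY := (contMDiffAt_section x₀).1 (hY x₀)
    rw [contMDiffAt_section]
    refine (hX.add hY).congr_of_eventuallyEq ?_
    filter_upwards [(trivializationAt 𝔨 L x₀).open_baseSet.mem_nhds
      (mem_baseSet_trivializationAt 𝔨 L x₀)] with y hy
    exact ((trivializationAt 𝔨 L x₀).linear K hy).map_add _ _
  smul_mem' c X hX := by
    intro x₀
    have hX := (contMDiffAt_section x₀).1 (hX x₀)
    rw [contMDiffAt_section]
    refine (((contDiff_const_smul_fiber c).contMDiff.of_le le_top).contMDiffAt.comp x₀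
      hX).congr_of_eventuallyEq ?_
    filter_upwards [(trivializationAt 𝔨 L x₀).open_baseSet.mem_nhds
      (mem_baseSet_trivializationAt 𝔨 L x₀)] with y hy
    exact ((trivializationAt 𝔨 L x₀).linear K hy).map_smul _ _

/-- The pointwise bracket on `Γ^k(L)`. -/
instance LieSections.instBracket [FiniteDimensional K 𝔨] [IsLieAlgebraBundle 𝔨 L] (k : ℕ∞) :
    Bracket (LieSections K EM 𝔨 L k) (LieSections K EM 𝔨 L k) where
  bracket X Y := ⟨fun x ↦ ⁅X.1 x, Y.1 x⁆, by
    intro x₀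
    have hX := (contMDiffAt_section x₀).1 (X.2 x₀)
    have hY := (contMDiffAt_section x₀).1 (Y.2 x₀)
    rw [contMDiffAt_section]
    refine (((contDiff_lie_fiber K).contMDiff.of_le le_top).contMDiffAt.comp x₀
      (hX.prodMk_space hY)).congr_of_eventuallyEq ?_
    filter_upwards [(trivializationAt 𝔨 L x₀).open_baseSet.mem_nhds
      (mem_baseSet_trivializationAt 𝔨 L x₀)] with y hy
    exact IsLieAlgebraBundle.map_lie _ y hy _ _⟩

instance LieSections.instLieRing [FiniteDimensional K 𝔨] [IsLieAlgebraBundle 𝔨 L] (k : ℕ∞) :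
    LieRing (LieSections K EM 𝔨 L k) where
  add_lie X Y Z := Subtype.ext (funext fun x ↦ add_lie (X.1 x) (Y.1 x) (Z.1 x))
  lie_add X Y Z := Subtype.ext (funext fun x ↦ lie_add (X.1 x) (Y.1 x) (Z.1 x))
  lie_self X := Subtype.ext (funext fun x ↦ lie_self (X.1 x))
  leibniz_lie X Y Z := Subtype.ext (funext fun x ↦ leibniz_lie (X.1 x) (Y.1 x) (Z.1 x))

instance LieSections.instLieAlgebra [FiniteDimensional K 𝔨] [IsLieAlgebraBundle 𝔨 L] (k : ℕ∞) :
    LieAlgebra K (LieSections K EM 𝔨 L k) where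
  lie_smul c X Y := Subtype.ext (funext fun x ↦ lie_smul c (X.1 x) (Y.1 x))

variable [∀ x, IsTopologicalAddGroup (L x)] [∀ x, ContinuousSMul K (L x)]

/-- `Γ^k(Hom(L, L))`: the associative algebra, under pointwise composition, of `C^k` sections of the
endomorphism bundle of `L`, whose fiber at `x` is the space of `K`-linear maps `L x → L x` (they are
all continuous, as `L x` is finite-dimensional). Its bundle charts are `T ↦ φ ∘ T ∘ φ⁻¹` for bundle
charts `φ` of `L`. -/
def EndSections (k : ℕ∞) : Subalgebra K (Π x, L x →L[K] L x) where
  carrier := {T | ContMDiff 𝓘(ℝ, EM) (𝓘(ℝ, EM).prod 𝓘(ℝ, 𝔨 →L[K] 𝔨)) k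
    (fun x ↦ (⟨x, T x⟩ : TotalSpace (𝔨 →L[K] 𝔨) (fun x ↦ L x →L[K] L x)))}
  mul_mem' {S T} hS hT := by
    intro x₀
    have hS := (contMDiffAt_section x₀).1 (hS x₀)
    have hT := (contMDiffAt_section x₀).1 (hT x₀)
    rw [contMDiffAt_section]
    refine (((contDiff_comp_fiber (K := K) (𝔨 := 𝔨)).contMDiff.of_le le_top).contMDiffAt.comp x₀
      (hS.prodMk_space hT)).congr_of_eventuallyEq ?_
    filter_upwards [(trivializationAt 𝔨 L x₀).open_baseSet.mem_nhds
      (mem_baseSet_trivializationAt 𝔨 L x₀)] with y hy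
    ext v
    simp [hom_trivializationAt_apply, ContinuousLinearMap.inCoordinates,
      -Trivialization.continuousLinearMapAt_apply]
    rw [Trivialization.symmL_continuousLinearMapAt _ hy]
  add_mem' {S T} hS hT := by
    intro x₀
    have hS := (contMDiffAt_section x₀).1 (hS x₀)
    have hT := (contMDiffAt_section x₀).1 (hT x₀)
    rw [contMDiffAt_section]
    refine (hS.add hT).congr_of_eventuallyEq (Filter.Eventually.of_forall fun y ↦ ?_)
    ext v
    simp [hom_trivializationAt_apply, ContinuousLinearMap.inCoordinates]
  algebraMap_mem' c := by
    intro x₀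
    rw [contMDiffAt_section]
    refine (contMDiffAt_const (c := c • ContinuousLinearMap.id K 𝔨)).congr_of_eventuallyEq ?_
    filter_upwards [(trivializationAt 𝔨 L x₀).open_baseSet.mem_nhds
      (mem_baseSet_trivializationAt 𝔨 L x₀)] with y hy
    ext v
    simp [hom_trivializationAt_apply, ContinuousLinearMap.inCoordinates,
      -Trivialization.continuousLinearMapAt_apply]
    rw [Trivialization.continuousLinearMapAt_symmL _ hy]

/-- `Cent(L) ⊆ Hom(L, L)`: its fiber at `x` is the centroid of the Lie algebra `L x`. -/
def CentFiber (x : M) : Subalgebra K (L x →L[K] L x) :=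
  { (LieAlgebra.centroid K (L x)).toSubsemiring.comap ContinuousLinearMap.toLinearMapRingHom with
    algebraMap_mem' := fun c ↦ (LieAlgebra.centroid K (L x)).algebraMap_mem c }

set_option linter.unusedSectionVars false in
/-- Every bundle chart `φ` of `L` induces the bundle chart `T ↦ φ ∘ T ∘ φ⁻¹` of `Hom(L, L)`, and this
maps `Cent(L)` fiberwise onto the centroid of `𝔨`: so `Cent(L)` is the subbundle of `Hom(L, L)` with
typical fiber the centroid of `𝔨`. -/
theorem mem_centFiber_iff [IsLieAlgebraBundle 𝔨 L] (e : Trivialization 𝔨 (π 𝔨 L))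
    [MemTrivializationAtlas e] (x : M) (hx : x ∈ e.baseSet) (T : L x →L[K] L x) :
    T ∈ CentFiber K L x ↔
      ((e.continuousLinearMap (RingHom.id K) e ⟨x, T⟩).2 : 𝔨 →ₗ[K] 𝔨) ∈
        LieAlgebra.centroid K 𝔨 := by
  have hl : ∀ v w : L x, e.continuousLinearMapAt K x ⁅v, w⁆ =
      ⁅e.continuousLinearMapAt K x v, e.continuousLinearMapAt K x w⁆ := fun v w ↦ by
    simpa [Trivialization.linearMapAt_apply, hx] using
      IsLieAlgebraBundle.map_lie (𝔨 := 𝔨) (L := L) e x hx v w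
  have hs : ∀ a b : 𝔨, e.symmL K x ⁅a, b⁆ = ⁅e.symmL K x a, e.symmL K x b⁆ := fun a b ↦ by
    rw [← e.symmL_continuousLinearMapAt (R := K) hx ⁅e.symmL K x a, e.symmL K x b⁆, hl,
      e.continuousLinearMapAt_symmL hx, e.continuousLinearMapAt_symmL hx]
  rw [Trivialization.continuousLinearMap_apply]
  constructor
  · intro hT a b
    have hT' : ∀ v w : L x, T ⁅v, w⁆ = ⁅v, T w⁆ := hT
    change e.continuousLinearMapAt K x (T (e.symmL K x ⁅a, b⁆)) =
      ⁅a, e.continuousLinearMapAt K x (T (e.symmL K x b))⁆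
    rw [hs, hT', hl, e.continuousLinearMapAt_symmL hx]
  · intro hT v w
    have hT' : ∀ a b : 𝔨, e.continuousLinearMapAt K x (T (e.symmL K x ⁅a, b⁆)) =
      ⁅a, e.continuousLinearMapAt K x (T (e.symmL K x b))⁆ := hT
    have h := congrArg (e.symmL K x)
      (hT' (e.continuousLinearMapAt K x v) (e.continuousLinearMapAt K x w))
    rw [hs, hs] at h
    simp only [e.symmL_continuousLinearMapAt hx] at h
    exact h

/-- `Γ^k(Cent(L))`: the associative algebra, under pointwise composition, of `C^k` sections of the
bundle `Cent(L)`, i.e. of `C^k` sections of `Hom(L, L)` with values in the subbundle `Cent(L)`. -/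
def CentSections (k : ℕ∞) : Subalgebra K (Π x, L x →L[K] L x) where
  carrier := {T | T ∈ EndSections K EM 𝔨 L k ∧ ∀ x, T x ∈ CentFiber K L x}
  mul_mem' hS hT := ⟨mul_mem hS.1 hT.1, fun x ↦ mul_mem (hS.2 x) (hT.2 x)⟩
  add_mem' hS hT := ⟨add_mem hS.1 hT.1, fun x ↦ add_mem (hS.2 x) (hT.2 x)⟩
  algebraMap_mem' c := ⟨algebraMap_mem _ c, fun _ ↦ algebraMap_mem _ c⟩

end LieBundle

/-!
A `C^k` section `T` of `Cent(L)` acts on sections by `(T X) x = T x (X x)`, and this gives a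
homomorphism `CentSections.toCentroid` of associative algebras into the centroid of `Γ^k(L)`. It is
injective because every vector of a fiber is the value of a section. The content of the theorem is
that it is surjective: an element `A` of the centroid of `Γ^k(L)` acts pointwise, i.e. `X x = 0`
implies `(A X) x = 0` (`centroid_apply_eq_zero`). The resulting linear maps `T x` of the fibers are
in the centroids of the fibers, and they form a `C^k` section, since applying `A` to sections which
are constant in a chart gives `C^k` sections (`EndSections.mem_of_forall_apply_mem`).

If the fiber is centerfree, `A` acts pointwise because `⁅Y, A X⁆ x = -⁅X, A Y⁆ x = 0` for every
section `Y`, so `(A X) x` is central.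

If the fiber is perfect, then it suffices to write `X` as a finite sum of brackets `⁅Y a, Z a⁆` such
that `Y a` vanishes wherever `X` does, as `A ⁅Y a, Z a⁆ = ⁅Y a, A (Z a)⁆`. To have finite sums on a
noncompact manifold, finitely many smooth sections spanning every fiber are needed
(`exists_spanning_sections`). They are found by general position: the `N`-tuples of vectors which do
not span the fiber have codimension larger than the dimension of `M` for large `N`, so that a generic
perturbation spans on a given compact set (`dense_setOf_forall_span_eq_top`), and the theorem of
Baire handles the countably many compact sets of a covering. Since the fiber is perfect, the brackets
of the spanning sections span as well, and a partition of unity yields `C^k` coefficients of `X` with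
respect to these brackets (`LieSections.exists_coefficients`), which are absorbed into one factor of
each bracket.
-/

open Filter Topology

set_option linter.unusedSectionVars false

/-! ### Paracompact connected spaces -/

/-- Take a locally finite cover by relatively compact open sets. Starting from a point, the members
of the cover reached in at most `n` steps form a finite family, and by connectedness every member
is reached. -/
theorem sigmaCompactSpace_of_paracompact_connected (X : Type*) [TopologicalSpace X] [T2Space X]
    [LocallyCompactSpace X] [ParacompactSpace X] [ConnectedSpace X] : SigmaCompactSpace X := by
  obtain ⟨x₀⟩ := (inferInstance : Nonempty X)
  choose C hC hCx using fun x : X ↦ exists_compact_mem_nhds x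
  obtain ⟨v, hvo, hvc, hvf, hvC⟩ := precise_refinement (fun x ↦ interior (C x))
    (fun _ ↦ isOpen_interior)
    (Set.eq_univ_of_forall fun x ↦ Set.mem_iUnion.2 ⟨x, mem_interior_iff_mem_nhds.2 (hCx x)⟩)
  have hvk : ∀ a, IsCompact (closure (v a)) := fun a ↦
    (hC a).of_isClosed_subset isClosed_closure
      (closure_minimal ((hvC a).trans interior_subset) (hC a).isClosed)
  have hcov : ∀ x, ∃ a, x ∈ v a := fun x ↦ Set.mem_iUnion.1 (hvc ▸ Set.mem_univ x)
  -- The compact set `W n` is the union of the closures of the members reached at step `n`.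
  let W : ℕ → Set X := fun n ↦
    Nat.rec {x₀} (fun _ S ↦ ⋃ a ∈ {a | (v a ∩ S).Nonempty}, closure (v a)) n
  have hW : ∀ n, IsCompact (W n) := by
    intro n
    induction n with
    | zero => exact isCompact_singleton
    | succ n ih => exact (hvf.finite_nonempty_inter_compact ih).isCompact_biUnion fun a _ ↦ hvk a
  have hstep : ∀ n a, (v a ∩ W n).Nonempty → v a ⊆ W (n + 1) := fun n a h ↦
    subset_closure.trans (Set.subset_biUnion_of_mem (u := fun a ↦ closure (v a)) h)
  have hopen : IsOpen (⋃ n, W n) := isOpen_iff_mem_nhds.2 fun x hx ↦ by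
    obtain ⟨n, hn⟩ := Set.mem_iUnion.1 hx
    obtain ⟨a, ha⟩ := hcov x
    exact mem_of_superset ((hvo a).mem_nhds ha)
      ((hstep n a ⟨x, ha, hn⟩).trans (Set.subset_iUnion W (n + 1)))
  have hclosed : IsClosed (⋃ n, W n) := isClosed_of_closure_subset fun x hx ↦ by
    obtain ⟨a, ha⟩ := hcov x
    obtain ⟨y, hya, hy⟩ := mem_closure_iff.1 hx (v a) (hvo a) ha
    obtain ⟨n, hn⟩ := Set.mem_iUnion.1 hy
    exact Set.mem_iUnion.2 ⟨n + 1, hstep n a ⟨y, hya, hn⟩ ha⟩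
  refine SigmaCompactSpace.of_countable (Set.range W) (Set.countable_range W)
    (by rintro _ ⟨n, rfl⟩; exact hW n) ?_
  rw [Set.sUnion_range]
  exact IsClopen.eq_univ ⟨hclosed, hopen⟩ ⟨x₀, Set.mem_iUnion.2 ⟨0, rfl⟩⟩

/-! ### Spanning tuples -/

theorem contDiff_smul_real {K : Type*} [RCLike K] {F : Type*} [NormedAddCommGroup F]
    [NormedSpace K F] [NormedSpace ℝ F] [IsScalarTower ℝ K F]
    {E : Type*} [NormedAddCommGroup E] [NormedSpace ℝ E] {n : ℕ∞ω}
    {f : E → K} {g : E → F} (hf : ContDiff ℝ n f) (hg : ContDiff ℝ n g) :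
    ContDiff ℝ n fun x ↦ f x • g x := by
  have h : ContDiff ℝ n (fun p : K × F ↦ p.1 • p.2) := (contDiff_smul (𝕜 := K)).restrict_scalars ℝ
  exact h.comp (hf.prodMk hg)

section Spanning

variable {K : Type*} [RCLike K] {F : Type*} [NormedAddCommGroup F] [NormedSpace K F]
  [FiniteDimensional K F]

theorem eventually_span_range_eq_top {ι : Type*} [Finite ι] {t : ι → F}
    (ht : Submodule.span K (Set.range t) = ⊤) :
    ∀ᶠ t' in 𝓝 t, Submodule.span K (Set.range t') = ⊤ := by
  obtain ⟨κ, a, ha, hspan, hli⟩ := exists_linearIndependent' K t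
  have : Finite κ := Finite.of_injective a ha
  cases nonempty_fintype κ
  have hcard : Fintype.card κ = Module.finrank K F := by
    rw [← finrank_span_eq_card hli, hspan, ht, finrank_top]
  have hcont : Continuous fun t' : ι → F ↦ t' ∘ a :=
    continuous_pi fun i ↦ continuous_apply (a i)
  filter_upwards [hcont.continuousAt.eventually hli.eventually] with t' ht'
  exact top_le_iff.1 (((ht'.span_eq_top_of_card_eq_finrank' hcard).symm.le).trans
    (Submodule.span_mono (Set.range_comp_subset_range a t')))

/-- The tuples which do not span are contained in a hyperplane, so they are parametrized by the
`d - 1` vectors of a generating set of the hyperplane and a matrix of coefficients. -/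
theorem exists_coefficients_of_span_ne_top {ι : Type*} (t : ι → F)
    (ht : Submodule.span K (Set.range t) ≠ ⊤) :
    ∃ (b : ι → Fin (Module.finrank K F - 1) → K) (c : Fin (Module.finrank K F - 1) → F),
      ∀ j, t j = ∑ i, b j i • c i := by
  set H := Submodule.span K (Set.range t)
  have hlt : Module.finrank K H ≤ Module.finrank K F - 1 :=
    Nat.le_sub_one_of_lt (Submodule.finrank_lt ht)
  let B := Module.finBasis K H
  have hmem : ∀ j, t j ∈ H := fun j ↦ Submodule.subset_span ⟨j, rfl⟩
  let u := Fin.castLE hlt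
  have hu : Function.Injective u := Fin.castLE_injective hlt
  refine ⟨fun j ↦ Function.extend u (fun i ↦ B.repr ⟨t j, hmem j⟩ i) 0,
    Function.extend u (fun i ↦ (B i : F)) 0, fun j ↦ ?_⟩
  rw [← Fintype.sum_of_injective u hu (fun i ↦ B.repr ⟨t j, hmem j⟩ i • (B i : F)) _ ?_ ?_]
  · have := congrArg Subtype.val (B.sum_repr ⟨t j, hmem j⟩)
    simpa only [AddSubmonoidClass.coe_finsetSum, Submodule.coe_smul] using this.symm
  · intro i hi
    rw [Function.extend_apply' _ _ _ (by simpa using hi)]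
    simp
  · intro i
    simp [hu.extend_apply]

variable [NormedSpace ℝ F] [IsScalarTower ℝ K F]

/-- Sard-type argument: among families of `N` functions on a space of dimension `n` with values in
`F`, the generic one spans `F` at every point as soon as `N` is large, because the tuples which do
not span have large codimension. -/
theorem dense_setOf_forall_span_eq_top {E : Type*} [NormedAddCommGroup E] [NormedSpace ℝ E]
    [FiniteDimensional ℝ E] {N : ℕ}
    (hN : Module.finrank ℝ E + Module.finrank K F ^ 2 < N)
    {s : Set E} (hs : Convex ℝ s) {ζ : E → Fin N → F} (hζ : ContDiffOn ℝ 1 ζ s) :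
    Dense {δ : Fin N → F | ∀ x ∈ s, Submodule.span K (Set.range (ζ x + δ)) = ⊤} := by
  have : FiniteDimensional ℝ F := FiniteDimensional.trans ℝ K F
  set d := Module.finrank K F with hd
  rcases Nat.eq_zero_or_pos d with hd₀ | hd₀
  · have : Subsingleton F := Module.finrank_zero_iff.1 hd₀
    exact (dense_univ).mono fun δ _ x _ ↦ Subsingleton.elim _ _
  -- The bad `δ` are those for which some tuple `ζ x + δ` lies in a hyperplane. They form the image
  -- of a `C^1` map `f` from a space `P` of smaller dimension.
  let P := E × (Fin N → Fin (d - 1) → K) × (Fin (d - 1) → F)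
  let f : P → Fin N → F := fun p j ↦ (∑ i, p.2.1 j i • p.2.2 i) - ζ p.1 j
  have hf : ContDiffOn ℝ 1 f (s ×ˢ Set.univ) := by
    refine contDiffOn_pi.2 fun j ↦ ContDiffOn.sub (ContDiff.contDiffOn ?_) ?_
    · refine ContDiff.sum fun i _ ↦ contDiff_smul_real ?_ ?_ <;> fun_prop
    · exact (contDiffOn_pi.1 hζ j).comp contDiff_fst.contDiffOn fun p hp ↦ hp.1
  have hdim : Module.finrank ℝ P < Module.finrank ℝ (Fin N → F) := by
    have hF : Module.finrank ℝ F = Module.finrank ℝ K * d := (Module.finrank_mul_finrank ℝ K F).symm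
    have hc : 0 < Module.finrank ℝ K := Module.finrank_pos
    simp only [P, Module.finrank_prod, Module.finrank_pi_fintype, Finset.sum_const,
      Finset.card_univ, Fintype.card_fin, smul_eq_mul, hF]
    generalize Module.finrank ℝ K = c at hc
    generalize Module.finrank ℝ E = n at hN
    obtain ⟨m, hm⟩ : ∃ m, d = m + 1 := ⟨d - 1, by omega⟩
    rw [hm] at hN ⊢
    simp only [Nat.add_sub_cancel]
    have h : n + (m + 1) * m < N := by nlinarith
    calc n + (N * (m * c) + m * (c * (m + 1))) ≤ c * (n + (m + 1) * m) + N * (m * c) := by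
          nlinarith [Nat.le_mul_of_pos_left n hc]
      _ < c * N + N * (m * c) := by gcongr
      _ = N * (c * (m + 1)) := by ring
  have hdense : Dense (f '' (s ×ˢ Set.univ))ᶜ := by
    refine hf.dense_compl_image_of_dimH_lt_finrank (hs.prod convex_univ) subset_rfl ?_
    refine (dimH_mono (Set.subset_univ _)).trans_lt ?_
    rw [Real.dimH_univ_eq_finrank]
    exact_mod_cast hdim
  refine hdense.mono fun δ hδ x hx ↦ ?_
  by_contra hne
  refine hδ ?_
  obtain ⟨b, c, hbc⟩ := exists_coefficients_of_span_ne_top _ hne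
  refine ⟨(x, b, c), ⟨hx, trivial⟩, funext fun j ↦ ?_⟩
  exact sub_eq_of_eq_add' (hbc j).symm

/-- If `C^k` functions `w a` span `F` at `x₀`, then near `x₀` every vector can be expanded in them
with coefficients depending linearly on the vector and in a `C^k` way on the point. -/
theorem exists_coefficients_of_span_eq_top {EM : Type*} [NormedAddCommGroup EM] [NormedSpace ℝ EM]
    {M : Type*} [TopologicalSpace M] [ChartedSpace EM M] {ι : Type*} [Fintype ι] {k : ℕ∞}
    {w : ι → M → F} {x₀ : M}
    (hw : ∀ a, ∀ᶠ x in 𝓝 x₀, ContMDiffAt 𝓘(ℝ, EM) 𝓘(ℝ, F) k (w a) x)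
    (hspan : Submodule.span K (Set.range fun a ↦ w a x₀) = ⊤) :
    ∃ g : M → F →L[K] (ι → K), ∀ᶠ x in 𝓝 x₀,
      ContMDiffAt 𝓘(ℝ, EM) 𝓘(ℝ, F →L[K] (ι → K)) k g x ∧ ∀ v, ∑ a, g x v a • w a x = v := by
  have : CompleteSpace F := FiniteDimensional.complete K F
  have hsurj : LinearMap.range (Fintype.linearCombination K fun a ↦ w a x₀) = ⊤ := by
    rw [Fintype.range_linearCombination, hspan]
  obtain ⟨r', hr'⟩ := LinearMap.exists_rightInverse_of_surjective _ hsurj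
  let r : F →L[K] (ι → K) := LinearMap.toContinuousLinearMap r'
  let ra : ι → F →L[K] K := fun a ↦ (ContinuousLinearMap.proj a).comp r
  -- The coefficients `r` are the right ones at `x₀`, where `Φ` is the identity; at nearby points
  -- they are corrected by the inverse of `Φ`.
  let Φ : M → F →L[K] F := fun x ↦ ∑ a, (ra a).smulRight (w a x)
  have hΦv : ∀ x v, Φ x v = ∑ a, r v a • w a x := fun x v ↦ by simp [Φ, ra]
  have hΦ₀ : Φ x₀ = 1 := by
    ext v
    rw [hΦv]
    exact LinearMap.congr_fun hr' v
  have hΦs : ∀ᶠ x in 𝓝 x₀, ContMDiffAt 𝓘(ℝ, EM) 𝓘(ℝ, F →L[K] F) k Φ x := by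
    filter_upwards [eventually_all.2 hw] with x hx
    refine contMDiffAt_finsetSum fun a _ ↦ ?_
    have h : ContDiff ℝ ω fun v : F ↦ (ra a).smulRight v :=
      ((ContinuousLinearMap.smulRightL K F F (ra a)).contDiff).restrict_scalars ℝ
    exact ((h.contMDiff.of_le le_top).contMDiffAt).comp x (hx a)
  have hunit : ∀ᶠ x in 𝓝 x₀, IsUnit (Φ x) := by
    refine hΦs.self_of_nhds.continuousAt.eventually ?_
    rw [hΦ₀]
    exact Units.isOpen.mem_nhds isUnit_one
  refine ⟨fun x ↦ r.comp (Ring.inverse (Φ x)), ?_⟩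
  filter_upwards [hΦs, hunit] with x hx hu
  constructor
  · have h1 : ContDiffAt ℝ k (Ring.inverse : (F →L[K] F) → _) (Φ x) :=
      (contDiffAt_ringInverse K hu.unit).restrict_scalars ℝ
    have h2 : ContDiff ℝ k fun T : F →L[K] F ↦ r.comp T :=
      ((ContinuousLinearMap.compL K F F (ι → K) r).contDiff).restrict_scalars ℝ
    exact (h2.contDiffAt.comp _ h1).contMDiffAt.comp x hx
  · intro v
    have h : Φ x (Ring.inverse (Φ x) v) = v :=
      congrArg (fun T : F →L[K] F ↦ T v) (Ring.mul_inverse_cancel _ hu)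
    rw [hΦv] at h
    exact h

end Spanning

/-! ### Sections of a bundle of Lie algebras -/


section Sections

variable {K : Type*} [RCLike K]
  {EM : Type*} [NormedAddCommGroup EM] [NormedSpace ℝ EM]
  {M : Type*} [TopologicalSpace M] [ChartedSpace EM M]
  {𝔨 : Type*} [NormedLieRing 𝔨] [NormedLieAlgebra K 𝔨] [NormedSpace ℝ 𝔨] [IsScalarTower ℝ K 𝔨]
  {L : M → Type*} [∀ x, LieRing (L x)] [∀ x, LieAlgebra K (L x)]
  [∀ x, TopologicalSpace (L x)] [TopologicalSpace (TotalSpace 𝔨 L)] [FiberBundle 𝔨 L]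
  [VectorBundle K 𝔨 L]

variable (K) in
theorem span_range_trivialization_eq_top_iff (e : Trivialization 𝔨 (π 𝔨 L))
    [MemTrivializationAtlas e] {x : M} (hx : x ∈ e.baseSet) {ι : Type*} (w : ι → L x) :
    Submodule.span K (Set.range fun a ↦ (e ⟨x, w a⟩).2) = ⊤ ↔
      Submodule.span K (Set.range w) = ⊤ := by
  have h : (Set.range fun a ↦ (e ⟨x, w a⟩).2) = e.linearEquivAt K x hx '' Set.range w := by
    rw [← Set.range_comp]
    rfl
  rw [h, ← LinearEquiv.coe_coe, ← Submodule.map_span,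
    LinearMap.map_eq_top_iff (LinearEquiv.range _), LinearEquiv.ker, sup_bot_eq]

theorem eventually_mem_baseSet_trivializationAt (x₀ : M) :
    ∀ᶠ x in 𝓝 x₀, x ∈ (trivializationAt 𝔨 L x₀).baseSet :=
  (trivializationAt 𝔨 L x₀).open_baseSet.mem_nhds (mem_baseSet_trivializationAt 𝔨 L x₀)

theorem LieSections.mono {k l : ℕ∞} (h : k ≤ l) :
    LieSections K EM 𝔨 L l ≤ LieSections K EM 𝔨 L k := fun _ hX ↦
  ContMDiff.of_le (n := (l : ℕ∞ω)) hX (by exact_mod_cast h)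

theorem LieSections.coord_contMDiffAt [∀ x, Module ℝ (L x)] [VectorBundle ℝ 𝔨 L]
    [ContMDiffVectorBundle ∞ 𝔨 L 𝓘(ℝ, EM)] {k : ℕ∞} (X : LieSections K EM 𝔨 L k)
    (e : Trivialization 𝔨 (π 𝔨 L)) [MemTrivializationAtlas e] {x : M} (hx : x ∈ e.baseSet) :
    ContMDiffAt 𝓘(ℝ, EM) 𝓘(ℝ, 𝔨) k (fun y ↦ (e ⟨y, X.1 y⟩).2) x := by
  have : ContMDiffVectorBundle k 𝔨 L 𝓘(ℝ, EM) :=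
    ContMDiffVectorBundle.of_le (n := ∞) (by exact_mod_cast le_top)
  exact (e.contMDiffAt_section_iff hx).1 (X.2 x)

theorem LieSections.smul_fun_mem {k : ℕ∞} {X : Π x, L x} (hX : X ∈ LieSections K EM 𝔨 L k)
    {g : M → K} (hg : ContMDiff 𝓘(ℝ, EM) 𝓘(ℝ, K) k g) :
    (fun x ↦ g x • X x) ∈ LieSections K EM 𝔨 L k := by
  intro x₀
  have hX := (contMDiffAt_section x₀).1 (hX x₀)
  rw [contMDiffAt_section]
  have h : ContDiff ℝ k (fun p : K × 𝔨 ↦ p.1 • p.2) := contDiff_smul_real contDiff_fst contDiff_snd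
  refine (h.contMDiff.contMDiffAt.comp x₀ ((hg x₀).prodMk_space hX)).congr_of_eventuallyEq ?_
  filter_upwards [eventually_mem_baseSet_trivializationAt (𝔨 := 𝔨) (L := L) x₀] with y hy
  exact ((trivializationAt 𝔨 L x₀).linear K hy).map_smul _ _

theorem LieSections.mem_of_eventuallyEq {k : ℕ∞} {X : Π x, L x}
    (h : ∀ x₀, ∃ Y ∈ LieSections K EM 𝔨 L k, ∀ᶠ x in 𝓝 x₀, X x = Y x) :
    X ∈ LieSections K EM 𝔨 L k := fun x₀ ↦ by
  obtain ⟨Y, hY, hXY⟩ := h x₀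
  refine (hY x₀).congr_of_eventuallyEq ?_
  filter_upwards [hXY] with x hx
  rw [hx]

theorem LieSections.finsum_mem {k : ℕ∞} {ι : Type*} {X : ι → Π x, L x}
    (hX : ∀ i, X i ∈ LieSections K EM 𝔨 L k) (hf : LocallyFinite fun i ↦ {x | X i x ≠ 0}) :
    (fun x ↦ ∑ᶠ i, X i x) ∈ LieSections K EM 𝔨 L k := by
  refine LieSections.mem_of_eventuallyEq fun x₀ ↦ ?_
  obtain ⟨U, hU, hfin⟩ := hf x₀
  refine ⟨∑ i ∈ hfin.toFinset, X i, sum_mem fun i _ ↦ hX i, ?_⟩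
  filter_upwards [hU] with x hx
  rw [Finset.sum_apply]
  refine finsum_eq_sum_of_support_subset _ fun i hi ↦ ?_
  simpa using ⟨x, hi, hx⟩

/-- The section which is the constant `v` in the bundle chart at `c`, cut off by a bump function
around `c`. It depends linearly on `v`. -/
noncomputable def bumpSection (K : Type*) [RCLike K] {𝔨 : Type*} [NormedLieRing 𝔨]
    [NormedLieAlgebra K 𝔨]
    (L : M → Type*) [∀ x, LieRing (L x)] [∀ x, LieAlgebra K (L x)]
    [∀ x, TopologicalSpace (L x)] [TopologicalSpace (TotalSpace 𝔨 L)] [FiberBundle 𝔨 L]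
    [VectorBundle K 𝔨 L] [FiniteDimensional ℝ EM] {c : M} (f : SmoothBumpFunction 𝓘(ℝ, EM) c) :
    𝔨 →ₗ[K] Π x, L x :=
  LinearMap.pi fun x ↦ ((f x : ℝ) : K) • (trivializationAt 𝔨 L c).symmₗ K x

section Bump

variable [FiniteDimensional ℝ EM] {c : M} (f : SmoothBumpFunction 𝓘(ℝ, EM) c)

theorem bumpSection_eq_zero {v : 𝔨} {x : M} (hx : f x = 0) : bumpSection K L f v x = 0 := by
  simp [bumpSection, hx]

theorem coord_bumpSection (v : 𝔨) {x : M} (hx : x ∈ (trivializationAt 𝔨 L c).baseSet) :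
    (trivializationAt 𝔨 L c ⟨x, bumpSection K L f v x⟩).2 = ((f x : ℝ) : K) • v := by
  have h := ((trivializationAt 𝔨 L c).linear K hx).map_smul ((f x : ℝ) : K)
    ((trivializationAt 𝔨 L c).symm x v)
  rw [Trivialization.apply_mk_symm _ hx] at h
  rw [← h, bumpSection, LinearMap.pi_apply, LinearMap.smul_apply, Trivialization.coe_symmₗ _ hx]

theorem bumpSection_mem [T2Space M] [IsManifold 𝓘(ℝ, EM) ∞ M] [∀ x, Module ℝ (L x)]
    [VectorBundle ℝ 𝔨 L] [ContMDiffVectorBundle ∞ 𝔨 L 𝓘(ℝ, EM)]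
    {f : SmoothBumpFunction 𝓘(ℝ, EM) c}
    (hf : tsupport f ⊆ (trivializationAt 𝔨 L c).baseSet) (v : 𝔨) :
    bumpSection K L f v ∈ LieSections K EM 𝔨 L ⊤ := by
  intro x
  by_cases hx : x ∈ tsupport f
  · rw [(trivializationAt 𝔨 L c).contMDiffAt_section_iff (hf hx)]
    have h : ContDiff ℝ ∞ fun r : ℝ ↦ r • v := contDiff_id.smul contDiff_const
    refine (h.contMDiff.contMDiffAt.comp x f.contMDiffAt).congr_of_eventuallyEq ?_
    filter_upwards [(trivializationAt 𝔨 L c).open_baseSet.mem_nhds (hf hx)] with y hy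
    rw [coord_bumpSection f v hy]
    simp
  · refine ((LieSections K EM 𝔨 L ⊤).zero_mem x).congr_of_eventuallyEq ?_
    filter_upwards [(isClosed_tsupport f).isOpen_compl.mem_nhds hx] with y hy
    rw [bumpSection_eq_zero f (image_eq_zero_of_notMem_tsupport hy)]
    rfl

end Bump

end Sections

/-! ### Finitely many sections spanning every fiber -/

section Generators

variable {K : Type*} [RCLike K]
  {EM : Type*} [NormedAddCommGroup EM] [NormedSpace ℝ EM] [FiniteDimensional ℝ EM]
  {M : Type*} [TopologicalSpace M] [ChartedSpace EM M] [IsManifold 𝓘(ℝ, EM) ∞ M] [T2Space M]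
  {𝔨 : Type*} [NormedLieRing 𝔨] [NormedLieAlgebra K 𝔨] [FiniteDimensional K 𝔨]
  [NormedSpace ℝ 𝔨] [IsScalarTower ℝ K 𝔨]
  {L : M → Type*} [∀ x, LieRing (L x)] [∀ x, LieAlgebra K (L x)] [∀ x, Module ℝ (L x)]
  [∀ x, TopologicalSpace (L x)] [TopologicalSpace (TotalSpace 𝔨 L)] [FiberBundle 𝔨 L]
  [VectorBundle K 𝔨 L] [VectorBundle ℝ 𝔨 L] [ContMDiffVectorBundle ∞ 𝔨 L 𝓘(ℝ, EM)]

/-- The locally finite sum of the constants `c i`, each cut off by the bump function `f i`. -/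
noncomputable def bumpSum {ι : Type*} (f : SmoothBumpCovering ι 𝓘(ℝ, EM) M)
    (K : Type*) [RCLike K] {𝔨 : Type*} [NormedLieRing 𝔨] [NormedLieAlgebra K 𝔨]
    (L : M → Type*) [∀ x, LieRing (L x)] [∀ x, LieAlgebra K (L x)]
    [∀ x, TopologicalSpace (L x)] [TopologicalSpace (TotalSpace 𝔨 L)] [FiberBundle 𝔨 L]
    [VectorBundle K 𝔨 L] (c : ι → 𝔨) (x : M) : L x :=
  ∑ᶠ i, bumpSection K L (f i) (c i) x

section BumpSum

variable {ι : Type*} {f : SmoothBumpCovering ι 𝓘(ℝ, EM) M}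

theorem support_bumpSection_subset (f : SmoothBumpCovering ι 𝓘(ℝ, EM) M) (c : ι → 𝔨) (i : ι) :
    {x | bumpSection K L (f i) (c i) x ≠ 0} ⊆ Function.support (f i) := fun _ hx h0 ↦
  hx (bumpSection_eq_zero _ h0)

theorem bumpSum_mem (hf : f.IsSubordinate fun x ↦ (trivializationAt 𝔨 L x).baseSet)
    (c : ι → 𝔨) : bumpSum f K L c ∈ LieSections K EM 𝔨 L ⊤ :=
  LieSections.finsum_mem (fun i ↦ bumpSection_mem (hf i) (c i))
    (f.locallyFinite.subset (support_bumpSection_subset f c))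

/-- Near a point, the sum has finitely many terms, the same ones for all constants. -/
theorem exists_finset_bumpSum_eq (f : SmoothBumpCovering ι 𝓘(ℝ, EM) M) (x₀ : M) :
    ∃ t : Finset ι, ∀ᶠ x in 𝓝 x₀, ∀ c : ι → 𝔨,
      bumpSum f K L c x = ∑ i ∈ t, bumpSection K L (f i) (c i) x := by
  obtain ⟨U, hU, hfin⟩ := f.locallyFinite x₀
  refine ⟨hfin.toFinset, ?_⟩
  filter_upwards [hU] with x hx c
  refine finsum_eq_sum_of_support_subset _ fun i hi ↦ ?_
  simpa using ⟨x, support_bumpSection_subset f c i hi, hx⟩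

theorem bumpSum_add_single [DecidableEq ι] (c : ι → 𝔨) (i : ι) (v : 𝔨) (x : M) :
    bumpSum f K L (c + Pi.single i v) x = bumpSum f K L c x + bumpSection K L (f i) v x := by
  obtain ⟨t, ht⟩ := exists_finset_bumpSum_eq (K := K) (L := L) (𝔨 := 𝔨) f x
  have hs : bumpSum f K L (Pi.single i v) x = bumpSection K L (f i) v x := by
    refine (finsum_eq_single _ i fun j hj ↦ ?_).trans ?_
    · simp [hj]
    · simp
  rw [← hs, ht.self_of_nhds, ht.self_of_nhds, ht.self_of_nhds, ← Finset.sum_add_distrib]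
  simp

/-- Joint continuity in the constants and the point, for the product topology on the constants. -/
theorem continuousAt_coord_bumpSum
    (hf : f.IsSubordinate fun x ↦ (trivializationAt 𝔨 L x).baseSet)
    (e : Trivialization 𝔨 (π 𝔨 L)) [MemTrivializationAtlas e] {x₀ : M} (hx₀ : x₀ ∈ e.baseSet)
    (c₀ : ι → 𝔨) :
    ContinuousAt (fun p : (ι → 𝔨) × M ↦ (e ⟨p.2, bumpSum f K L p.1 p.2⟩).2) (c₀, x₀) := by
  obtain ⟨t, ht⟩ := exists_finset_bumpSum_eq (K := K) (L := L) (𝔨 := 𝔨) f x₀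
  let B := Module.finBasis K 𝔨
  have heq : (fun p : (ι → 𝔨) × M ↦ (e ⟨p.2, bumpSum f K L p.1 p.2⟩).2) =ᶠ[𝓝 (c₀, x₀)]
      fun p ↦ ∑ i ∈ t, ∑ b, B.equivFunL (p.1 i) b •
        (e ⟨p.2, bumpSection K L (f i) (B b) p.2⟩).2 := by
    filter_upwards [continuous_snd.continuousAt.eventually ht,
      continuous_snd.continuousAt.eventually (e.open_baseSet.mem_nhds hx₀)] with p hp he
    rw [hp]
    refine (map_sum (e.linearEquivAt K p.2 he) _ t).trans (Finset.sum_congr rfl fun i _ ↦ ?_)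
    let ℓ : 𝔨 →ₗ[K] 𝔨 :=
      (e.linearEquivAt K p.2 he).toLinearMap ∘ₗ LinearMap.proj p.2 ∘ₗ bumpSection K L (f i)
    have h := congrArg ℓ (B.sum_equivFun (p.1 i))
    rw [map_sum] at h
    simp only [map_smul] at h
    exact h.symm
  refine ContinuousAt.congr ?_ heq.symm
  refine tendsto_finsetSum _ fun i _ ↦ tendsto_finsetSum _ fun b _ ↦ Tendsto.smul ?_ ?_
  · have : Continuous fun p : (ι → 𝔨) × M ↦ B.equivFunL (p.1 i) b := by fun_prop
    exact this.continuousAt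
  · have h := (LieSections.coord_contMDiffAt ⟨_, bumpSection_mem (K := K) (hf i) (B b)⟩ e
      hx₀).continuousAt
    exact ContinuousAt.comp (x := (c₀, x₀)) (f := Prod.snd) h continuous_snd.continuousAt

theorem eventually_span_bumpSum
    (hf : f.IsSubordinate fun x ↦ (trivializationAt 𝔨 L x).baseSet) {κ : Type*} [Finite κ]
    {c₀ : κ → ι → 𝔨} {y : M}
    (hc₀ : Submodule.span K (Set.range fun j ↦ bumpSum f K L (c₀ j) y) = ⊤) :
    ∀ᶠ p : (κ → ι → 𝔨) × M in 𝓝 (c₀, y),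
      Submodule.span K (Set.range fun j ↦ bumpSum f K L (p.1 j) p.2) = ⊤ := by
  let e := trivializationAt 𝔨 L y
  have hye : y ∈ e.baseSet := mem_baseSet_trivializationAt 𝔨 L y
  have hcont : ContinuousAt (fun p : (κ → ι → 𝔨) × M ↦ fun j ↦
      (e ⟨p.2, bumpSum f K L (p.1 j) p.2⟩).2) (c₀, y) := by
    refine continuousAt_pi.2 fun j ↦ ?_
    have h : Continuous fun p : (κ → ι → 𝔨) × M ↦ (p.1 j, p.2) := by fun_prop
    exact ContinuousAt.comp (x := (c₀, y)) (f := fun p : (κ → ι → 𝔨) × M ↦ (p.1 j, p.2))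
      (continuousAt_coord_bumpSum hf e hye (c₀ j)) h.continuousAt
  have hspan := (span_range_trivialization_eq_top_iff K e hye _).2 hc₀
  filter_upwards [hcont.eventually (eventually_span_range_eq_top hspan),
    continuous_snd.continuousAt.eventually (e.open_baseSet.mem_nhds hye)] with p hp he
  exact (span_range_trivialization_eq_top_iff K e he _).1 hp

/-- The condition that the sections span on the compact set where `f i` is `1` is open. -/
theorem isOpen_setOf_span_bumpSum
    (hf : f.IsSubordinate fun x ↦ (trivializationAt 𝔨 L x).baseSet) {N : ℕ} (i : ι) :
    IsOpen {c : Fin N → ι → 𝔨 | ∀ x, f i x = 1 →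
      Submodule.span K (Set.range fun j ↦ bumpSum f K L (c j) x) = ⊤} := by
  refine isOpen_iff_mem_nhds.2 fun c₀ hc₀ ↦ ?_
  have hK : IsCompact {x | f i x = 1} := by
    refine (f i).hasCompactSupport.of_isClosed_subset
      (isClosed_eq (f i).continuous continuous_const) fun x hx ↦ subset_closure ?_
    simp [Function.mem_support, show f i x = 1 from hx]
  exact hK.eventually_forall_of_forall_eventually (P := fun (c : Fin N → ι → 𝔨) x ↦
    Submodule.span K (Set.range fun j ↦ bumpSum f K L (c j) x) = ⊤) fun y hy ↦
      eventually_span_bumpSum hf (hc₀ y hy)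

/-- The condition that the sections span where `f i` is `1` is dense, since the constants belonging
to the index `i` alone can be perturbed to achieve it. -/
theorem dense_setOf_span_bumpSum
    (hf : f.IsSubordinate fun x ↦ (trivializationAt 𝔨 L x).baseSet) {N : ℕ}
    (hN : Module.finrank ℝ EM + Module.finrank K 𝔨 ^ 2 < N) (i : ι) :
    Dense {c : Fin N → ι → 𝔨 | ∀ x, f i x = 1 →
      Submodule.span K (Set.range fun j ↦ bumpSum f K L (c j) x) = ⊤} := by
  classical
  intro c₀
  let e := trivializationAt 𝔨 L (f.c i)
  let φ := extChartAt 𝓘(ℝ, EM) (f.c i)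
  let s : Set EM := Metric.ball (φ (f.c i)) (f i).rOut
  -- The sections given by `c₀`, in the bundle chart (`q`) and in the chart of `M` (`ζ`).
  let q : M → Fin N → 𝔨 := fun y j ↦ (e ⟨y, bumpSum f K L (c₀ j) y⟩).2
  let ζ : EM → Fin N → 𝔨 := fun u ↦ q (φ.symm u)
  have hst : s ⊆ φ.target := fun u hu ↦ (f i).ball_subset ⟨hu, by simp⟩
  have hse : ∀ u ∈ s, φ.symm u ∈ e.baseSet := fun u hu ↦ by
    refine hf i (subset_closure ?_)
    rw [(f i).support_eq_symm_image]
    exact ⟨u, ⟨hu, by simp⟩, rfl⟩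
  have hζ : ContDiffOn ℝ 1 ζ s := by
    refine contDiffOn_pi.2 fun j ↦ ContMDiffOn.contDiffOn fun u hu ↦ ?_
    have h1 := (LieSections.coord_contMDiffAt ⟨_, bumpSum_mem (K := K) hf (c₀ j)⟩ e
      (hse u hu)).of_le (m := 1) (by exact_mod_cast le_top)
    have h2 : ContMDiffWithinAt 𝓘(ℝ, EM) 𝓘(ℝ, EM) 1 φ.symm s u :=
      (((contMDiffOn_extChartAt_symm (n := ∞) (I := 𝓘(ℝ, EM)) (f.c i)).of_le
        (by exact_mod_cast le_top)) u (hst hu)).mono hst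
    exact h1.comp_contMDiffWithinAt u h2
  have hdense := dense_setOf_forall_span_eq_top (K := K) hN (convex_ball _ _ : Convex ℝ s) hζ
  refine mem_closure_iff_nhds.2 fun O hO ↦ ?_
  -- Adding `δ` to the constants at `i` shifts the sections by `δ` in the bundle chart, on the set
  -- where `f i` is `1`.
  let p : (Fin N → 𝔨) → Fin N → ι → 𝔨 := fun δ j ↦ c₀ j + Pi.single i (δ j)
  have hp : Continuous p := by
    refine continuous_pi fun j ↦ continuous_const.add ?_
    exact (continuous_single i).comp (continuous_apply j)
  have hp0 : p 0 = c₀ := by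
    ext j
    simp [p]
  have hO' : p ⁻¹' O ∈ 𝓝 0 := hp.continuousAt.preimage_mem_nhds (by rwa [hp0])
  obtain ⟨δ, hδO, hδ⟩ := mem_closure_iff_nhds.1 (hdense 0) _ hO'
  refine ⟨p δ, hδO, fun x hx ↦ ?_⟩
  have hxs : x ∈ Function.support (f i) := by simp [Function.mem_support, hx]
  have hxe : x ∈ e.baseSet := hf i (subset_closure hxs)
  rw [(f i).support_eq_inter_preimage] at hxs
  have hxφ : φ.symm (φ x) = x := φ.left_inv (by simpa [φ] using hxs.1)
  rw [← span_range_trivialization_eq_top_iff K e hxe]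
  have hδx := hδ (φ x) hxs.2
  rw [show ζ (φ x) = q x from congrArg q hxφ] at hδx
  convert hδx using 4 with j
  have hadd := ((trivializationAt 𝔨 L (f.c i)).linear K hxe).map_add
    (bumpSum f K L (c₀ j) x) (bumpSection K L (f i) (δ j) x)
  have hco := coord_bumpSection (K := K) (f i) (δ j) hxe
  simp only [p, q, Pi.add_apply, bumpSum_add_single]
  rw [hx, RCLike.ofReal_one, one_smul] at hco
  exact hadd.trans (congrArg _ hco)

end BumpSum

/-- A vector bundle over a finite-dimensional `σ`-compact manifold has finitely many smooth sections
which span every fiber. Take a covering by bump functions `f i`, and consider the families of `N`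
sections which are sums of constants in charts, cut off by the `f i`. To span on the compact set
where `f i` is `1` is an open and dense condition on the constants, if `N` is large. By the theorem
of Baire, all these conditions can be satisfied at once. -/
theorem exists_spanning_sections [SigmaCompactSpace M] :
    ∃ (N : ℕ) (Z : Fin N → LieSections K EM 𝔨 L ⊤),
      ∀ x, Submodule.span K (Set.range fun j ↦ (Z j).1 x) = ⊤ := by
  obtain ⟨ι, f, hf⟩ := SmoothBumpCovering.exists_isSubordinate 𝓘(ℝ, EM)
    (U := fun x : M ↦ (trivializationAt 𝔨 L x).baseSet) isClosed_univ
    fun x _ ↦ eventually_mem_baseSet_trivializationAt x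
  have : Countable ι := Set.countable_univ_iff.1
    (f.locallyFinite.countable_univ fun i ↦ (f i).nonempty_support)
  have : CompleteSpace 𝔨 := FiniteDimensional.complete K 𝔨
  let N := Module.finrank ℝ EM + Module.finrank K 𝔨 ^ 2 + 1
  obtain ⟨c, hc⟩ := (dense_iInter_of_isOpen
    (isOpen_setOf_span_bumpSum (K := K) (N := N) hf)
    (dense_setOf_span_bumpSum (K := K) hf (Nat.lt_succ_self _))).nonempty
  refine ⟨N, fun j ↦ ⟨bumpSum f K L (c j), bumpSum_mem hf (c j)⟩, fun x ↦ ?_⟩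
  exact Set.mem_iInter.1 hc (f.ind x trivial) x (f.apply_ind x trivial)

/-- If `C^k` sections `W a` span every fiber, then every `C^k` section is a linear combination of
them with `C^k` coefficients, and these can be chosen to vanish wherever the section does. The local
coefficients given by linear algebra are glued by a partition of unity. -/
theorem LieSections.exists_coefficients [SigmaCompactSpace M] {ι : Type*} [Fintype ι] {k : ℕ∞}
    (W : ι → LieSections K EM 𝔨 L k)
    (hW : ∀ x, Submodule.span K (Set.range fun a ↦ (W a).1 x) = ⊤) (X : LieSections K EM 𝔨 L k) :
    ∃ g : ι → M → K, (∀ a, ContMDiff 𝓘(ℝ, EM) 𝓘(ℝ, K) k (g a)) ∧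
      (∀ x, X.1 x = ∑ a, g a x • (W a).1 x) ∧ ∀ x, X.1 x = 0 → ∀ a, g a x = 0 := by
  let t : M → Set (ι → K) := fun x ↦
    {g | X.1 x = ∑ a, g a • (W a).1 x ∧ (X.1 x = 0 → g = 0)}
  have ht : ∀ x, Convex ℝ (t x) := by
    rintro x g ⟨hg, hg0⟩ h ⟨hh, hh0⟩ α β - - hαβ
    constructor
    · have hK : (α : K) + (β : K) = 1 := by exact_mod_cast congrArg (RCLike.ofReal (K := K)) hαβ
      calc X.1 x = (α : K) • X.1 x + (β : K) • X.1 x := by rw [← add_smul, hK, one_smul]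
        _ = (α : K) • ∑ a, g a • (W a).1 x + (β : K) • ∑ a, h a • (W a).1 x := by rw [← hg, ← hh]
        _ = _ := by
          simp only [Finset.smul_sum, ← Finset.sum_add_distrib, smul_smul, ← add_smul]
          simp [Algebra.smul_def]
    · intro h0
      simp [hg0 h0, hh0 h0]
  obtain ⟨g, hg⟩ := exists_contMDiffMap_forall_mem_convex_of_local 𝓘(ℝ, EM) (n := k) ht
    fun x₀ ↦ by
      let e := trivializationAt 𝔨 L x₀
      have he := eventually_mem_baseSet_trivializationAt (𝔨 := 𝔨) (L := L) x₀
      obtain ⟨r, hr⟩ := exists_coefficients_of_span_eq_top (K := K) (EM := EM)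
        (w := fun a y ↦ (e ⟨y, (W a).1 y⟩).2) (x₀ := x₀) (k := k)
        (fun a ↦ he.mono fun x hx ↦ LieSections.coord_contMDiffAt (W a) e hx)
        ((span_range_trivialization_eq_top_iff K e he.self_of_nhds _).2 (hW x₀))
      refine ⟨_, he.and hr, fun y ↦ r y (e ⟨y, X.1 y⟩).2, ?_, ?_⟩
      · rintro x ⟨hx, hrx, -⟩
        have happ : ContDiff ℝ k (fun p : (𝔨 →L[K] (ι → K)) × 𝔨 ↦ p.1 p.2) :=
          (isBoundedBilinearMap_apply (𝕜 := K) (E := 𝔨) (F := ι → K)).contDiff.restrict_scalars ℝ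
        exact (happ.contMDiff.contMDiffAt.comp x
          (hrx.prodMk_space (LieSections.coord_contMDiffAt X e hx))).contMDiffWithinAt
      · rintro x ⟨hx, -, hrx⟩
        constructor
        · apply (e.linearEquivAt K x hx).injective
          rw [map_sum]
          simp only [map_smul]
          exact (hrx (e ⟨x, X.1 x⟩).2).symm
        · intro h0
          have h : (e ⟨x, X.1 x⟩).2 = 0 := by
            rw [h0]
            exact (e.linearEquivAt K x hx).map_zero
          simp only [h, map_zero]
  refine ⟨fun a x ↦ g x a, fun a ↦ ?_, fun x ↦ (hg x).1, fun x h0 a ↦ congrFun ((hg x).2 h0) a⟩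
  exact (contMDiff_pi_space.1 g.contMDiff) a

end Generators

/-! ### Elements of the centroid act pointwise -/

theorem LieAlgebra.IsPerfect.span_range_lie_eq_top {K : Type*} [CommRing K] {𝔤 : Type*} [LieRing 𝔤]
    [LieAlgebra K 𝔤] (h : LieAlgebra.IsPerfect K 𝔤) {ι : Type*} {t : ι → 𝔤}
    (ht : Submodule.span K (Set.range t) = ⊤) :
    Submodule.span K (Set.range fun p : ι × ι ↦ ⁅t p.1, t p.2⁆) = ⊤ := by
  let β : 𝔤 →ₗ[K] 𝔤 →ₗ[K] 𝔤 := (LieModule.toEnd K 𝔤 𝔤 : 𝔤 →ₗ[K] 𝔤 →ₗ[K] 𝔤)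
  have hβ := Submodule.map₂_span_span K β (Set.range t) (Set.range t)
  rw [ht, Set.image2_range] at hβ
  refine top_le_iff.1 ?_
  rw [← h]
  refine Submodule.span_le.2 ?_
  rintro _ ⟨x, y, rfl⟩
  have hxy : β x y ∈ Submodule.map₂ β ⊤ ⊤ := Submodule.apply_mem_map₂ β trivial trivial
  rw [hβ] at hxy
  exact hxy

section Centroid

variable {K : Type*} [RCLike K]
  {EM : Type*} [NormedAddCommGroup EM] [NormedSpace ℝ EM] [FiniteDimensional ℝ EM]
  {M : Type*} [TopologicalSpace M] [ChartedSpace EM M] [IsManifold 𝓘(ℝ, EM) ∞ M] [T2Space M]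
  {𝔨 : Type*} [NormedLieRing 𝔨] [NormedLieAlgebra K 𝔨] [FiniteDimensional K 𝔨]
  [NormedSpace ℝ 𝔨] [IsScalarTower ℝ K 𝔨]
  {L : M → Type*} [∀ x, LieRing (L x)] [∀ x, LieAlgebra K (L x)] [∀ x, Module ℝ (L x)]
  [∀ x, TopologicalSpace (L x)] [TopologicalSpace (TotalSpace 𝔨 L)] [FiberBundle 𝔨 L]
  [VectorBundle K 𝔨 L] [VectorBundle ℝ 𝔨 L] [ContMDiffVectorBundle ∞ 𝔨 L 𝓘(ℝ, EM)]

variable (𝔨 L) in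
theorem exists_smoothBumpFunction_tsupport_subset_baseSet (x₀ : M) :
    ∃ f : SmoothBumpFunction 𝓘(ℝ, EM) x₀, tsupport f ⊆ (trivializationAt 𝔨 L x₀).baseSet := by
  obtain ⟨f, -, hf⟩ := (SmoothBumpFunction.nhds_basis_tsupport (I := 𝓘(ℝ, EM)) x₀).mem_iff.1
    (eventually_mem_baseSet_trivializationAt (𝔨 := 𝔨) (L := L) x₀)
  exact ⟨f, hf⟩

variable (K) in
/-- The section `bumpSection`, as an element of `Γ^k`. -/
noncomputable def LieSections.bump {x₀ : M} {f : SmoothBumpFunction 𝓘(ℝ, EM) x₀}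
    (hf : tsupport f ⊆ (trivializationAt 𝔨 L x₀).baseSet) (k : ℕ∞) :
    𝔨 →ₗ[K] LieSections K EM 𝔨 L k :=
  (bumpSection K L f).codRestrict _ fun v ↦ LieSections.mono le_top (bumpSection_mem hf v)

theorem LieSections.bump_apply_trivialization {x₀ : M} {f : SmoothBumpFunction 𝓘(ℝ, EM) x₀}
    (hf : tsupport f ⊆ (trivializationAt 𝔨 L x₀).baseSet) (k : ℕ∞) {x : M}
    (hx : x ∈ (trivializationAt 𝔨 L x₀).baseSet) (hfx : f x = 1) (v : L x) :
    (LieSections.bump K hf k (trivializationAt 𝔨 L x₀ ⟨x, v⟩).2).1 x = v := by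
  refine ((trivializationAt 𝔨 L x₀).linearEquivAt K x hx).injective ?_
  refine (coord_bumpSection f _ hx).trans ?_
  rw [hfx, RCLike.ofReal_one, one_smul]
  rfl

variable (K EM 𝔨) in
theorem LieSections.exists_apply_eq (k : ℕ∞) {x : M} (v : L x) :
    ∃ X : LieSections K EM 𝔨 L k, X.1 x = v := by
  obtain ⟨f, hf⟩ := exists_smoothBumpFunction_tsupport_subset_baseSet (EM := EM) 𝔨 L x
  exact ⟨_, LieSections.bump_apply_trivialization hf k (mem_baseSet_trivializationAt 𝔨 L x)
    f.eq_one v⟩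

variable [IsLieAlgebraBundle 𝔨 L]

variable (𝔨) in
theorem eq_zero_of_forall_lie_eq_zero (h𝔨 : LieAlgebra.IsCenterfree K 𝔨) {x : M} {v : L x}
    (hv : ∀ w : L x, ⁅w, v⁆ = 0) : v = 0 := by
  let e := trivializationAt 𝔨 L x
  have hx : x ∈ e.baseSet := mem_baseSet_trivializationAt 𝔨 L x
  let E := e.linearEquivAt K x hx
  have hE : ∀ v w : L x, E ⁅v, w⁆ = ⁅E v, E w⁆ := IsLieAlgebraBundle.map_lie e x hx
  have hc : E v ∈ LieAlgebra.center K 𝔨 := by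
    refine (LieModule.mem_maxTrivSubmodule K 𝔨 𝔨 _).2 fun a ↦ ?_
    rw [← E.apply_symm_apply a, ← hE, hv, map_zero]
  rw [h𝔨] at hc
  exact E.map_eq_zero_iff.1 hc

/-- For a perfect fiber, `Γ^k(L)` is perfect: more precisely every section `X` is a finite sum of
brackets in which one factor vanishes wherever `X` does. -/
theorem LieSections.exists_eq_sum_lie [SigmaCompactSpace M] (h𝔨 : LieAlgebra.IsPerfect K 𝔨)
    {k : ℕ∞} (X : LieSections K EM 𝔨 L k) :
    ∃ (ι : Type) (_ : Fintype ι) (Y Z : ι → LieSections K EM 𝔨 L k),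
      X = ∑ a, ⁅Y a, Z a⁆ ∧ ∀ x, X.1 x = 0 → ∀ a, (Y a).1 x = 0 := by
  obtain ⟨N, Z', hZ'⟩ := exists_spanning_sections (K := K) (EM := EM) (𝔨 := 𝔨) (L := L)
  let Z : Fin N → LieSections K EM 𝔨 L k := fun j ↦ ⟨Z' j, LieSections.mono le_top (Z' j).2⟩
  let W : Fin N × Fin N → LieSections K EM 𝔨 L k := fun p ↦ ⁅Z p.1, Z p.2⁆
  have hW : ∀ x, Submodule.span K (Set.range fun a ↦ (W a).1 x) = ⊤ := fun x ↦ by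
    let e := trivializationAt 𝔨 L x
    have hx : x ∈ e.baseSet := mem_baseSet_trivializationAt 𝔨 L x
    rw [← span_range_trivialization_eq_top_iff K e hx]
    have h := h𝔨.span_range_lie_eq_top
      ((span_range_trivialization_eq_top_iff K e hx _).2 (hZ' x))
    rw [show (fun p ↦ (e ⟨x, (W p).1 x⟩).2) = fun p : Fin N × Fin N ↦
      ⁅(e ⟨x, (Z' p.1).1 x⟩).2, (e ⟨x, (Z' p.2).1 x⟩).2⁆ from
        funext fun p ↦ IsLieAlgebraBundle.map_lie e x hx _ _]
    exact h
  obtain ⟨g, hg, hX, hg0⟩ := LieSections.exists_coefficients W hW X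
  refine ⟨Fin N × Fin N, inferInstance,
    fun p ↦ ⟨fun x ↦ g p x • (Z p.1).1 x, LieSections.smul_fun_mem (Z p.1).2 (hg p)⟩,
    fun p ↦ Z p.2, ?_, fun x hx p ↦ ?_⟩
  · refine Subtype.ext (funext fun x ↦ ?_)
    rw [hX, AddSubmonoidClass.coe_finsetSum, Finset.sum_apply]
    exact Finset.sum_congr rfl fun p _ ↦ (smul_lie (g p x) ((Z p.1).1 x) ((Z p.2).1 x)).symm
  · simp [hg0 x hx p]

/-- Elements of the centroid of `Γ^k(L)` act pointwise. If the fiber is centerfree, this holds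
because the value of `A X` commutes with the values of all sections. If it is perfect, then `X` is a
sum of brackets of sections, one of which vanishes at the point in question. -/
theorem centroid_apply_eq_zero [SigmaCompactSpace M]
    (h𝔨 : LieAlgebra.IsPerfect K 𝔨 ∨ LieAlgebra.IsCenterfree K 𝔨) {k : ℕ∞}
    {A : Module.End K (LieSections K EM 𝔨 L k)}
    (hA : A ∈ LieAlgebra.centroid K (LieSections K EM 𝔨 L k))
    {X : LieSections K EM 𝔨 L k} {x : M} (hX : X.1 x = 0) : (A X).1 x = 0 := by
  have hA' : ∀ Y Z : LieSections K EM 𝔨 L k, A ⁅Y, Z⁆ = ⁅Y, A Z⁆ := hA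
  have hlie : ∀ Y Z : LieSections K EM 𝔨 L k, Y.1 x = 0 → (⁅Y, Z⁆).1 x = 0 := fun Y Z hY ↦ by
    change ⁅Y.1 x, Z.1 x⁆ = 0
    rw [hY, zero_lie]
  rcases h𝔨 with h𝔨 | h𝔨
  · obtain ⟨ι, _, Y, Z, hYZ, hY⟩ := LieSections.exists_eq_sum_lie h𝔨 X
    rw [hYZ, map_sum, AddSubmonoidClass.coe_finsetSum, Finset.sum_apply]
    exact Finset.sum_eq_zero fun a _ ↦ by rw [hA', hlie _ _ (hY x hX a)]
  · refine eq_zero_of_forall_lie_eq_zero 𝔨 h𝔨 fun w ↦ ?_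
    obtain ⟨Y, rfl⟩ := LieSections.exists_apply_eq K EM 𝔨 k w
    change (⁅Y, A X⁆).1 x = 0
    rw [← hA', ← lie_skew, map_neg, hA']
    exact neg_eq_zero.2 (hlie _ _ hX)

theorem centroid_apply_congr [SigmaCompactSpace M]
    (h𝔨 : LieAlgebra.IsPerfect K 𝔨 ∨ LieAlgebra.IsCenterfree K 𝔨) {k : ℕ∞}
    {A : Module.End K (LieSections K EM 𝔨 L k)}
    (hA : A ∈ LieAlgebra.centroid K (LieSections K EM 𝔨 L k))
    {X Y : LieSections K EM 𝔨 L k} {x : M} (h : X.1 x = Y.1 x) : (A X).1 x = (A Y).1 x := by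
  have := centroid_apply_eq_zero h𝔨 hA (X := X - Y) (x := x) (sub_eq_zero.2 h)
  rw [map_sub] at this
  exact sub_eq_zero.1 this

end Centroid

/-! ### The isomorphism -/

section Iso

variable {K : Type*} [RCLike K]
  {EM : Type*} [NormedAddCommGroup EM] [NormedSpace ℝ EM] [FiniteDimensional ℝ EM]
  {M : Type*} [TopologicalSpace M] [ChartedSpace EM M] [IsManifold 𝓘(ℝ, EM) ∞ M] [T2Space M]
  {𝔨 : Type*} [NormedLieRing 𝔨] [NormedLieAlgebra K 𝔨] [FiniteDimensional K 𝔨]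
  [NormedSpace ℝ 𝔨] [IsScalarTower ℝ K 𝔨]
  {L : M → Type*} [∀ x, LieRing (L x)] [∀ x, LieAlgebra K (L x)] [∀ x, Module ℝ (L x)]
  [∀ x, TopologicalSpace (L x)] [∀ x, IsTopologicalAddGroup (L x)] [∀ x, ContinuousSMul K (L x)]
  [TopologicalSpace (TotalSpace 𝔨 L)] [FiberBundle 𝔨 L]
  [VectorBundle K 𝔨 L] [VectorBundle ℝ 𝔨 L] [ContMDiffVectorBundle ∞ 𝔨 L 𝓘(ℝ, EM)]

theorem EndSections.apply_mem {k : ℕ∞} {T : Π x, L x →L[K] L x} (hT : T ∈ EndSections K EM 𝔨 L k)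
    (X : LieSections K EM 𝔨 L k) : (fun x ↦ T x (X.1 x)) ∈ LieSections K EM 𝔨 L k := by
  intro x₀
  have hT := (contMDiffAt_section x₀).1 (hT x₀)
  have hX := (contMDiffAt_section x₀).1 (X.2 x₀)
  rw [contMDiffAt_section]
  have happ : ContDiff ℝ k (fun p : (𝔨 →L[K] 𝔨) × 𝔨 ↦ p.1 p.2) :=
    (isBoundedBilinearMap_apply (𝕜 := K) (E := 𝔨) (F := 𝔨)).contDiff.restrict_scalars ℝ
  refine (happ.contMDiff.contMDiffAt.comp x₀ (hT.prodMk_space hX)).congr_of_eventuallyEq ?_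
  filter_upwards [eventually_mem_baseSet_trivializationAt (𝔨 := 𝔨) (L := L) x₀] with y hy
  have h1 : (trivializationAt 𝔨 L x₀ ⟨y, X.1 y⟩).2 =
      (trivializationAt 𝔨 L x₀).continuousLinearMapAt K y (X.1 y) := by
    simp [Trivialization.linearMapAt_apply, hy]
  rw [Function.comp_apply, hom_trivializationAt_apply, h1]
  simp only [ContinuousLinearMap.inCoordinates, ContinuousLinearMap.comp_apply]
  rw [Trivialization.symmL_continuousLinearMapAt _ hy]
  simp [Trivialization.linearMapAt_apply, hy]

/-- The matrix entries of `T` in a chart are the coordinates of the images of sections which are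
constant in this chart near the given point. -/
theorem EndSections.mem_of_forall_apply_mem {k : ℕ∞} {T : Π x, L x →L[K] L x}
    (hT : ∀ X : LieSections K EM 𝔨 L k, (fun x ↦ T x (X.1 x)) ∈ LieSections K EM 𝔨 L k) :
    T ∈ EndSections K EM 𝔨 L k := by
  intro x₀
  rw [contMDiffAt_section]
  let e := trivializationAt 𝔨 L x₀
  have he : x₀ ∈ e.baseSet := mem_baseSet_trivializationAt 𝔨 L x₀
  obtain ⟨f, hf⟩ := exists_smoothBumpFunction_tsupport_subset_baseSet (EM := EM) 𝔨 L x₀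
  let B := Module.finBasis K 𝔨
  let b : Fin (Module.finrank K 𝔨) → 𝔨 →L[K] K := fun i ↦
    LinearMap.toContinuousLinearMap (B.coord i)
  let X := fun i ↦ LieSections.bump K hf k (B i)
  have hsm : ContMDiffAt 𝓘(ℝ, EM) 𝓘(ℝ, 𝔨 →L[K] 𝔨) k
      (fun x ↦ ∑ i, (b i).smulRight (e ⟨x, T x ((X i).1 x)⟩).2) x₀ := by
    refine contMDiffAt_finsetSum fun i _ ↦ ?_
    have h : ContDiff ℝ ω fun v : 𝔨 ↦ (b i).smulRight v :=
      ((ContinuousLinearMap.smulRightL K 𝔨 𝔨 (b i)).contDiff).restrict_scalars ℝ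
    exact ((h.contMDiff.of_le le_top).contMDiffAt).comp x₀
      (LieSections.coord_contMDiffAt ⟨_, hT (X i)⟩ e he)
  refine hsm.congr_of_eventuallyEq ?_
  filter_upwards [e.open_baseSet.mem_nhds he, f.eventuallyEq_one] with y hy hfy
  have hcoord : ∀ v : L y, (e ⟨y, v⟩).2 = e.continuousLinearMapAt K y v := fun v ↦ by
    simp [Trivialization.linearMapAt_apply, hy]
  have hX : ∀ i, (X i).1 y = e.symmL K y (B i) := fun i ↦ by
    have h := LieSections.bump_apply_trivialization (K := K) hf k hy hfy (e.symmL K y (B i))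
    rwa [hcoord, e.continuousLinearMapAt_symmL hy] at h
  rw [hom_trivializationAt_apply]
  refine ContinuousLinearMap.coe_injective (B.ext fun j ↦ ?_)
  simp [ContinuousLinearMap.inCoordinates, hX, hcoord, b, Finsupp.single_apply, e,
    -Trivialization.continuousLinearMapAt_apply, -Trivialization.symmL_apply]

variable [IsLieAlgebraBundle 𝔨 L]

variable (K EM 𝔨 L) in
/-- A `C^k` section of `Cent(L)` acts pointwise on `Γ^k(L)`, as an element of the centroid. -/
def CentSections.toCentroid (k : ℕ∞) :
    CentSections K EM 𝔨 L k →ₐ[K] LieAlgebra.centroid K (LieSections K EM 𝔨 L k) where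
  toFun T :=
    ⟨{  toFun := fun X ↦ ⟨fun x ↦ T.1 x (X.1 x), EndSections.apply_mem T.2.1 X⟩
        map_add' := fun X Y ↦ Subtype.ext (funext fun x ↦ (T.1 x).map_add (X.1 x) (Y.1 x))
        map_smul' := fun c X ↦ Subtype.ext (funext fun x ↦ (T.1 x).map_smul c (X.1 x)) },
      fun X Y ↦ Subtype.ext (funext fun x ↦ T.2.2 x (X.1 x) (Y.1 x))⟩
  map_one' := rfl
  map_mul' _ _ := rfl
  map_zero' := rfl
  map_add' _ _ := rfl
  commutes' _ := rfl

theorem CentSections.toCentroid_injective (k : ℕ∞) :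
    Function.Injective (CentSections.toCentroid K EM 𝔨 L k) := by
  intro S T h
  refine Subtype.ext (funext fun x ↦ ContinuousLinearMap.ext fun v ↦ ?_)
  obtain ⟨X, rfl⟩ := LieSections.exists_apply_eq K EM 𝔨 k v
  exact congrArg (fun A ↦ (A.1 X).1 x) h

theorem CentSections.toCentroid_surjective [SigmaCompactSpace M]
    (h𝔨 : LieAlgebra.IsPerfect K 𝔨 ∨ LieAlgebra.IsCenterfree K 𝔨) (k : ℕ∞) :
    Function.Surjective (CentSections.toCentroid K EM 𝔨 L k) := by
  rintro ⟨A, hA⟩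
  choose f hf using exists_smoothBumpFunction_tsupport_subset_baseSet (EM := EM) 𝔨 L
  have hmem := mem_baseSet_trivializationAt 𝔨 L
  -- `T x v` is the value at `x` of `A X`, where `X` is the section through `v` constructed from a
  -- chart and a bump function at `x`; this choice makes it linear in `v`.
  let S : Π x, 𝔨 →ₗ[K] L x := fun x ↦
    LinearMap.proj x ∘ₗ (LieSections K EM 𝔨 L k).subtype ∘ₗ A ∘ₗ LieSections.bump K (hf x) k
  let T : Π x, L x →L[K] L x := fun x ↦ (LinearMap.toContinuousLinearMap (S x)).comp
    ((trivializationAt 𝔨 L x).continuousLinearEquivAt K x (hmem x) : L x →L[K] 𝔨)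
  have hT : ∀ (X : LieSections K EM 𝔨 L k) x, T x (X.1 x) = (A X).1 x := fun X x ↦
    centroid_apply_congr h𝔨 hA
      (LieSections.bump_apply_trivialization (hf x) k (hmem x) (f x).eq_one (X.1 x))
  refine ⟨⟨T, EndSections.mem_of_forall_apply_mem fun X ↦ ?_, fun x v w ↦ ?_⟩, ?_⟩
  · simp only [hT]
    exact (A X).2
  · obtain ⟨X, rfl⟩ := LieSections.exists_apply_eq K EM 𝔨 k v
    obtain ⟨Y, rfl⟩ := LieSections.exists_apply_eq K EM 𝔨 k w
    exact (hT ⁅X, Y⁆ x).trans ((congrArg (fun Z ↦ Z.1 x) (hA X Y)).trans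
      (congrArg (fun u ↦ ⁅X.1 x, u⁆) (hT Y x).symm))
  · exact Subtype.ext (LinearMap.ext fun X ↦ Subtype.ext (funext fun x ↦ hT X x))

end Iso

theorem mainTheorem2 {K : Type*} [RCLike K]
    {EM : Type*} [NormedAddCommGroup EM] [NormedSpace ℝ EM] [FiniteDimensional ℝ EM]
    {M : Type*} [TopologicalSpace M] [ChartedSpace EM M] [IsManifold 𝓘(ℝ, EM) ∞ M]
    [T2Space M] [ParacompactSpace M] [ConnectedSpace M]
    {𝔨 : Type*} [NormedLieRing 𝔨] [NormedLieAlgebra K 𝔨] [FiniteDimensional K 𝔨]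
    [NormedSpace ℝ 𝔨] [IsScalarTower ℝ K 𝔨]
    {L : M → Type*} [∀ x, LieRing (L x)] [∀ x, LieAlgebra K (L x)]
    [∀ x, Module ℝ (L x)] [∀ x, IsScalarTower ℝ K (L x)]
    [∀ x, TopologicalSpace (L x)] [∀ x, IsTopologicalAddGroup (L x)]
    [∀ x, ContinuousSMul K (L x)]
    [TopologicalSpace (TotalSpace 𝔨 L)] [FiberBundle 𝔨 L] [VectorBundle K 𝔨 L]
    [VectorBundle ℝ 𝔨 L] [ContMDiffVectorBundle ∞ 𝔨 L 𝓘(ℝ, EM)] [IsLieAlgebraBundle 𝔨 L]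
    (h𝔨 : LieAlgebra.IsPerfect K 𝔨 ∨ LieAlgebra.IsCenterfree K 𝔨) (k : ℕ∞) :
    ∃ Ψ : LieAlgebra.centroid K (LieSections K EM 𝔨 L k) ≃ₐ[K] CentSections K EM 𝔨 L k,
      ∀ (A : LieAlgebra.centroid K (LieSections K EM 𝔨 L k)) (X : LieSections K EM 𝔨 L k) (x : M),
        (Ψ A).1 x (X.1 x) = (A.1 X).1 x := by
  have : LocallyCompactSpace M := ChartedSpace.locallyCompactSpace EM M
  have : SigmaCompactSpace M := sigmaCompactSpace_of_paracompact_connected M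
  let Φ := AlgEquiv.ofBijective (CentSections.toCentroid K EM 𝔨 L k)
    ⟨CentSections.toCentroid_injective k, CentSections.toCentroid_surjective h𝔨 k⟩
  refine ⟨Φ.symm, fun A X x ↦ ?_⟩
  exact congrArg (fun A' ↦ (A'.1 X).1 x) (Φ.apply_symm_apply A)
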